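/- Let $(\mathcal X,\rho)$ be a Polish space, i.e. a complete separable metric space with its Borel $\sigma$-field, let $\mu$ be a Borel probability measure on $\mathcal X$ with $\int\rho(x_0,x)^2\,d\mu(x)<\infty$ for some $x_0\in\mathcal X$, and let $a>0$. For each $n$, let $\mu^n$ be the $n$-fold product of $\mu$ on $\mathcal X^n$, let $\rho_2^n(x,y)=\big(\sum_{i=1}^n\rho(x^i,y^i)^2\big)^{1/2}$, and for $A\subset\mathcal X^n$ put $A^r=\{x\in\mathcal X^n:\ \exists\,y\in A,\ \rho_2^n(x,y)\le r\}$. For a Borel probability measure $\nu$ on $\mathcal X$ let $$W_2(\nu,\mu)^2=\inf_\pi\int\rho(x,y)^2\,d\pi(x,y)\in[0,\infty],$$ the infimum being over all probability measures $\pi$ on $\mathcal X\times\mathcal X$ with first marginal $\nu$ and second marginal $\mu$, and let $H(\nu\,|\,\mu)=\int\log\frac{d\nu}{d\mu}\,d\nu$ if $\nu\ll\mu$ and $H(\nu\,|\,\mu)=+\infty$ otherwise. The following are equivalent: 1. there are $r_0,b\ge 0$ such that for every $n$, every measurable $A\subset\mathcal X^n$ with $\mu^n(A)\ge 1/2$ and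 every $r\ge r_0$, $$\mu^n(A^r)\ \ge\ 1-b\,e^{-a(r-r_0)^2};$$ 2. $\mu$ satisfies Talagrand's inequality $\mathbf T_2(1/a)$: for every Borel probability measure $\nu$ on $\mathcal X$, $$W_2(\nu,\mu)^2\ \le\ \frac1a\,H(\nu\,|\,\mu).$$ -/

import Mathlib

open MeasureTheory
open scoped ENNReal

namespace GaussTransport

/-- The `ℓ²`-product metric `ρ₂ⁿ(x, y) = (∑ᵢ ρ(xᵢ, yᵢ)²)^{1/2}` on `Xⁿ`. -/
noncomputable def rhoTwo {X : Type*} [MetricSpace X] {n : ℕ} (x y : Fin n → X) : ℝ :=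
  Real.sqrt (∑ i, dist (x i) (y i) ^ 2)

/-- The `r`-enlargement `A^r = {x ∈ Xⁿ : ∃ y ∈ A, ρ₂ⁿ(x, y) ≤ r}`. -/
def enlargement {X : Type*} [MetricSpace X] {n : ℕ} (A : Set (Fin n → X)) (r : ℝ) :
    Set (Fin n → X) :=
  {x | ∃ y ∈ A, rhoTwo x y ≤ r}

/-- The `n`-fold product measure `μⁿ` on `Xⁿ`. -/
noncomputable def power {X : Type*} [MeasurableSpace X] (μ : Measure X) (n : ℕ) :
    Measure (Fin n → X) :=
  Measure.pi fun _ => μ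

/-- For every `n`, every measurable `A ⊆ Xⁿ` with `μⁿ(A) ≥ 1/2` and every `r ≥ r₀`,
`μⁿ(A^r) ≥ 1 - b exp(-a (r - r₀)²)`. (The set `A^r` is analytic, hence measurable for the
completion of `μⁿ`, and its measure below is the one given by the completion.) -/
def GaussianConcentration {X : Type*} [MetricSpace X] [MeasurableSpace X]
    (μ : Measure X) (a b r₀ : ℝ) : Prop :=
  ∀ (n : ℕ) (A : Set (Fin n → X)), MeasurableSet A → 1 / 2 ≤ (power μ n).real A →
    ∀ r : ℝ, r₀ ≤ r →
      1 - b * Real.exp (-a * (r - r₀) ^ 2) ≤ (power μ n).real (enlargement A r)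

/-- Finite second moment: `∫ ρ(x₀, x)² dμ(x) < ∞` for some `x₀`. -/
def HasFiniteSecondMoment {X : Type*} [MetricSpace X] [MeasurableSpace X]
    (μ : Measure X) : Prop :=
  ∃ x₀ : X, ∫⁻ x, edist x₀ x ^ 2 ∂μ < ∞

/-- The measures on `X × X` with marginals `ν` and `μ`. -/
def couplings {X : Type*} [MeasurableSpace X] (ν μ : Measure X) : Set (Measure (X × X)) :=
  {π | π.map Prod.fst = ν ∧ π.map Prod.snd = μ}

/-- The quadratic transport cost `T₂(ν, μ) = W₂(ν, μ)²`, with values in `[0, ∞]`. -/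
noncomputable def transportCost {X : Type*} [MetricSpace X] [MeasurableSpace X]
    (ν μ : Measure X) : ℝ≥0∞ :=
  ⨅ π ∈ couplings ν μ, ∫⁻ z, edist z.1 z.2 ^ 2 ∂π

/-- Talagrand's inequality `T₂(C)`: `W₂(ν, μ)² ≤ C · H(ν | μ)` for every probability
measure `ν` on `X`. -/
def TalagrandT2 {X : Type*} [MetricSpace X] [MeasurableSpace X]
    (μ : Measure X) (C : ℝ) : Prop :=
  ∀ ν : Measure X, IsProbabilityMeasure ν →
    transportCost ν μ ≤ ENNReal.ofReal C * InformationTheory.klDiv ν μ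

end GaussTransport

namespace GaussTransport

open Filter Topology Set ProbabilityTheory
open scoped BoundedContinuousFunction NNReal

/-! ### Laws of large numbers for samples and empirical measures. -/

section Sampling

variable {X : Type*} [MeasurableSpace X]

/-! Concentration implies transport by a large deviation argument. Let `H(ν|μ) < t < a c`. Samples
of size `N` typical for `ν` form a set `B` with `μ^N(B) ≥ e^{-Nt}/2`, by change of measure. Samples
typical for `μ` form a set `A` of mass at least `1/2`, and the complement of `A^r` with `r = √(Nc)`
has mass at most `b e^{-a(r-r₀)²}`, which is smaller once `N` is large. So some `x ∈ B` lies within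
`r` of some `y ∈ A`, and pairing their coordinates gives a plan of cost at most `c` between
empirical measures close to `ν` and `μ` (`exists_cheap_plan`). Compactness makes the marginals exact
(`exists_coupling_of_approx`), and `c` decreases to `H/a`.

Conversely, T₂ tested on the measure with density proportional to `e^{aQf}`, where `Q` is infimal
convolution with the squared distance, gives `∫ e^{aQf} dμ ≤ e^{a∫f dμ}`
(`TalagrandT2.integral_exp_infConv_le`). This tensorizes with the same constant
(`TalagrandT2.integral_exp_infConv_power_le`). Applied to the truncated squared distance to `A`,
first with a negative and then with a positive factor, it bounds the mean and then the upper tail of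
that distance independently of `n`. -/

instance isProbabilityMeasure_power (μ : Measure X) [IsProbabilityMeasure μ] (n : ℕ) :
    IsProbabilityMeasure (power μ n) := by
  unfold power; infer_instance

lemma measurePreserving_cons (μ : Measure X) [IsProbabilityMeasure μ] (n : ℕ) :
    MeasurePreserving (fun z : X × (Fin n → X) => (Fin.cons z.1 z.2 : Fin (n + 1) → X))
      (μ.prod (power μ n)) (power μ (n + 1)) := by
  have := (measurePreserving_piFinSuccAbove (fun _ : Fin (n + 1) => μ) 0).symm
  unfold power
  convert this using 1
  ext z i
  simp [MeasurableEquiv.piFinSuccAbove_symm_apply, Fin.insertNthEquiv]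

lemma integral_power_succ (μ : Measure X) [IsProbabilityMeasure μ] {n : ℕ}
    {G : (Fin (n + 1) → X) → ℝ} (hG : Integrable G (power μ (n + 1))) :
    Integrable (fun x => ∫ x₀, G (Fin.cons x₀ x) ∂μ) (power μ n) ∧
      ∫ x, G x ∂(power μ (n + 1)) = ∫ x, ∫ x₀, G (Fin.cons x₀ x) ∂μ ∂(power μ n) := by
  have hmp := measurePreserving_cons μ n
  have hint : Integrable (fun z : X × (Fin n → X) => G (Fin.cons z.1 z.2)) (μ.prod (power μ n)) :=
    hmp.integrable_comp_of_integrable hG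
  refine ⟨hint.integral_prod_right, ?_⟩
  rw [← integral_prod_symm _ hint, ← hmp.map_eq, integral_map (hmp.aemeasurable)]
  rw [hmp.map_eq]; exact hG.aestronglyMeasurable

lemma map_infinitePi_eq_power (ν : Measure X) [IsProbabilityMeasure ν] (n : ℕ) :
    (Measure.infinitePi fun _ : ℕ => ν).map (fun ω (i : Fin n) => ω i) = power ν n := by
  rw [Measure.map_infinitePi_infinitePi_of_inj (P := fun _ : ℕ => ν) Fin.val_injective,
    Measure.infinitePi_eq_pi, power]

/-- Weak law of large numbers for the product measures `νⁿ`. -/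
lemma tendsto_power_deviation (ν : Measure X) [IsProbabilityMeasure ν] {g : X → ℝ}
    (hg : Measurable g) (hint : Integrable g ν) {δ : ℝ} (hδ : 0 < δ) :
    Tendsto (fun n : ℕ => power ν (n + 1)
      {x | δ ≤ |(∑ i, g (x i)) / ((n + 1 : ℕ) : ℝ) - ∫ y, g y ∂ν|}) atTop (𝓝 0) := by
  set P := Measure.infinitePi fun _ : ℕ => ν
  have hev (i : ℕ) : MeasurePreserving (fun ω : ℕ → X => ω i) P ν :=
    ⟨measurable_pi_apply i, Measure.infinitePi_map_eval _ i⟩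
  have hindep : iIndepFun (fun (i : ℕ) (ω : ℕ → X) => g (ω i)) P :=
    iIndepFun_infinitePi fun _ => hg
  have hident (i : ℕ) : IdentDistrib (fun ω : ℕ → X => g (ω i)) (fun ω : ℕ → X => g (ω 0)) P P := by
    refine IdentDistrib.comp (u := g) ⟨(hev i).aemeasurable, (hev 0).aemeasurable, ?_⟩ hg
    rw [(hev i).map_eq, (hev 0).map_eq]
  have hint0 : Integrable (fun ω : ℕ → X => g (ω 0)) P := (hev 0).integrable_comp_of_integrable hint
  have hlaw := strong_law_ae_real (fun i (ω : ℕ → X) => g (ω i)) hint0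
    (fun i j hij => hindep.indepFun hij) hident
  have hmean : ∫ ω, g (ω 0) ∂P = ∫ y, g y ∂ν := by
    rw [← (hev 0).map_eq, integral_map (hev 0).aemeasurable]
    rw [(hev 0).map_eq]; exact hg.aestronglyMeasurable
  have hmeas (n : ℕ) : Measurable fun ω : ℕ → X => (∑ i ∈ Finset.range n, g (ω i)) / (n : ℝ) := by
    fun_prop
  have htend := tendstoInMeasure_iff_norm.1
    (tendstoInMeasure_of_tendsto_ae (fun n => (hmeas n).aestronglyMeasurable) hlaw) δ hδ
  refine ((tendsto_add_atTop_iff_nat 1).2 htend).congr fun n => ?_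
  rw [← map_infinitePi_eq_power, Measure.map_apply (by fun_prop)]
  · simp only [hmean, preimage_ofPred_eq, Real.norm_eq_abs, Finset.sum_range, P]
  · exact measurableSet_le measurable_const (by fun_prop)

/-- The empirical measure of a sample of size `n + 1`. -/
noncomputable def empirical {n : ℕ} (x : Fin (n + 1) → X) : ProbabilityMeasure X :=
  ⟨((n + 1 : ℕ) : ℝ≥0∞)⁻¹ • ∑ i, Measure.dirac (x i), ⟨by
    simp only [Measure.smul_apply, Measure.finsetSum_apply, measure_univ, Finset.sum_const,
      Finset.card_univ, Fintype.card_fin, nsmul_eq_mul, mul_one, smul_eq_mul]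
    exact ENNReal.inv_mul_cancel (by simp) (by simp)⟩⟩

lemma coe_empirical {n : ℕ} (x : Fin (n + 1) → X) :
    (empirical x : Measure X) = ((n + 1 : ℕ) : ℝ≥0∞)⁻¹ • ∑ i, Measure.dirac (x i) := rfl

lemma integral_empirical {n : ℕ} (x : Fin (n + 1) → X) {g : X → ℝ} (hg : Measurable g) :
    ∫ y, g y ∂(empirical x : Measure X) = (∑ i, g (x i)) / ((n + 1 : ℕ) : ℝ) := by
  rw [coe_empirical, integral_smul_measure, integral_finsetSum_measure]
  · simp only [integral_dirac' _ _ hg.stronglyMeasurable, ENNReal.toReal_inv,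
      ENNReal.toReal_natCast, smul_eq_mul]
    rw [div_eq_inv_mul]
  · intro i _
    exact integrable_dirac' hg.stronglyMeasurable (by simp [enorm_lt_top])

lemma lintegral_empirical {n : ℕ} (x : Fin (n + 1) → X) {g : X → ℝ≥0∞} (hg : Measurable g) :
    ∫⁻ y, g y ∂(empirical x : Measure X) = ((n + 1 : ℕ) : ℝ≥0∞)⁻¹ * ∑ i, g (x i) := by
  rw [coe_empirical, lintegral_smul_measure, lintegral_finsetSum_measure]
  simp only [lintegral_dirac' _ hg, smul_eq_mul]

lemma map_empirical {Y : Type*} [MeasurableSpace Y] {n : ℕ} (x : Fin (n + 1) → X) {g : X → Y}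
    (hg : Measurable g) :
    (empirical x).map hg.aemeasurable = empirical fun i => g (x i) := by
  apply Subtype.ext
  change Measure.map g (empirical x : Measure X) = (empirical fun i => g (x i) : Measure Y)
  rw [coe_empirical, coe_empirical, Measure.map_smul]
  congr 1
  rw [← Measure.mapₗ_apply_of_measurable hg, map_sum]
  simp only [Measure.mapₗ_apply_of_measurable hg, Measure.map_dirac' hg]

/-- Weak law of large numbers for empirical measures in the topology of weak convergence. -/
lemma tendsto_power_empirical_notMem [TopologicalSpace X] [OpensMeasurableSpace X]
    (ν : ProbabilityMeasure X) {U : Set (ProbabilityMeasure X)} (hU : U ∈ 𝓝 ν) :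
    Tendsto (fun n : ℕ => power (ν : Measure X) (n + 1) {x | empirical x ∉ U}) atTop (𝓝 0) := by
  -- The events whose complements have vanishing probability form a filter, by the union bound. Weak
  -- convergence along it can be tested on one bounded continuous function at a time, where the
  -- scalar law applies.
  let F : Filter (ProbabilityMeasure X) :=
    { sets := {U | Tendsto (fun n : ℕ => power (ν : Measure X) (n + 1) {x | empirical x ∉ U})
        atTop (𝓝 0)}
      univ_sets := by simp
      sets_of_superset := fun {s t} hs hst =>
        tendsto_of_tendsto_of_tendsto_of_le_of_le tendsto_const_nhds hs (fun _ => zero_le)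
          (fun n => measure_mono fun x hx h => hx (hst h))
      inter_sets := fun {s t} hs ht => by
        have h := hs.add ht
        rw [add_zero] at h
        refine tendsto_of_tendsto_of_tendsto_of_le_of_le tendsto_const_nhds h
          (fun _ => zero_le) fun n => ?_
        refine (measure_mono fun x hx => ?_).trans (measure_union_le _ _)
        simp only [mem_ofPred_eq, mem_inter_iff, not_and_or] at hx
        exact hx }
  have hF : Tendsto id F (𝓝 ν) := by
    rw [ProbabilityMeasure.tendsto_iff_forall_integral_tendsto]
    intro f
    rw [Metric.tendsto_nhds]
    intro δ hδ
    have h := tendsto_power_deviation (ν : Measure X) f.continuous.measurable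
      (f.integrable (ν : Measure X)) hδ
    refine h.congr fun n => ?_
    congr 1
    ext x
    simp [integral_empirical x f.continuous.measurable, Real.dist_eq]
  exact hF hU

end Sampling

/-! ### Change of measure between `νⁿ` and `μⁿ`. -/

section Entropy

variable {X : Type*} [MeasurableSpace X]

lemma power_withDensity (μ : Measure X) [IsProbabilityMeasure μ] {f : X → ℝ≥0∞} (hf : Measurable f)
    [IsProbabilityMeasure (μ.withDensity f)] (n : ℕ) :
    power (μ.withDensity f) n = (power μ n).withDensity fun x => ∏ i, f (x i) := by
  refine Measure.pi_eq fun s hs => ?_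
  have hind (i : Fin n) : Measurable ((s i).indicator f) := hf.indicator (hs i)
  have hindep : iIndepFun (fun (i : Fin n) (x : Fin n → X) => (s i).indicator f (x i))
      (Measure.pi fun _ => μ) := iIndepFun_pi fun i => (hind i).aemeasurable
  have hprod (x : Fin n → X) : (univ.pi s).indicator (fun x => ∏ i, f (x i)) x
      = ∏ i, (s i).indicator f (x i) := by
    by_cases hx : x ∈ univ.pi s
    · rw [indicator_of_mem hx]
      exact Finset.prod_congr rfl fun i _ => (indicator_of_mem (hx i (mem_univ i)) f).symm
    · rw [indicator_of_notMem hx]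
      obtain ⟨i, hi⟩ : ∃ i, x i ∉ s i := by simpa [Set.mem_pi] using hx
      exact (Finset.prod_eq_zero (Finset.mem_univ i) (indicator_of_notMem hi f)).symm
  rw [withDensity_apply _ (.univ_pi hs), ← lintegral_indicator (.univ_pi hs)]
  simp_rw [hprod, power]
  rw [lintegral_prod_eq_prod_lintegral_of_indepFun _ _ hindep
    fun i => (hind i).comp (measurable_pi_apply i)]
  refine Finset.prod_congr rfl fun i _ => ?_
  rw [withDensity_apply _ (hs i), ← lintegral_indicator (hs i)]
  rw [(measurePreserving_eval (fun _ : Fin n => μ) i).lintegral_comp (hind i)]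

/-- Change of measure: on a set where the sum of log-likelihood ratios is at most `t`, the measure
`νⁿ` is bounded by `exp t` times `μⁿ`. -/
lemma power_le_exp_mul_power {μ ν : Measure X} [IsProbabilityMeasure μ] [IsProbabilityMeasure ν]
    (hνμ : ν ≪ μ) {n : ℕ} {B : Set (Fin n → X)} (hB : MeasurableSet B) {t : ℝ}
    (ht : ∀ x ∈ B, ∑ i, llr ν μ (x i) ≤ t) :
    (power ν n).real B ≤ Real.exp t * (power μ n).real B := by
  set f : X → ℝ≥0∞ := fun x => ENNReal.ofReal (ν.rnDeriv μ x).toReal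
  have hf : Measurable f := by fun_prop
  have hfν : μ.withDensity f = ν := by
    rw [← Measure.withDensity_rnDeriv_eq ν μ hνμ]
    refine withDensity_congr_ae ?_
    filter_upwards [Measure.rnDeriv_lt_top ν μ] with x hx
    exact ENNReal.ofReal_toReal hx.ne
  have hprob : IsProbabilityMeasure (μ.withDensity f) := hfν ▸ inferInstance
  -- This holds at every point: where `f` vanishes, `Real.log 0 = 0` makes the right side 1.
  have hexp (x : X) : f x ≤ ENNReal.ofReal (Real.exp (llr ν μ x)) := by
    exact ENNReal.ofReal_le_ofReal (Real.le_exp_log _)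
  have key : power ν n B ≤ ENNReal.ofReal (Real.exp t) * power μ n B := by
    conv_lhs => rw [← hfν, power_withDensity μ hf, withDensity_apply _ hB]
    rw [← setLIntegral_const]
    refine setLIntegral_mono measurable_const fun x hx => ?_
    calc ∏ i, f (x i) ≤ ∏ i, ENNReal.ofReal (Real.exp (llr ν μ (x i))) :=
          Finset.prod_le_prod' fun i _ => hexp _
      _ = ENNReal.ofReal (Real.exp (∑ i, llr ν μ (x i))) := by
          rw [Real.exp_sum, ENNReal.ofReal_prod_of_nonneg fun i _ => (Real.exp_pos _).le]
      _ ≤ _ := ENNReal.ofReal_le_ofReal (Real.exp_le_exp.2 (ht x hx))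
  have := ENNReal.toReal_mono (ENNReal.mul_ne_top ENNReal.ofReal_ne_top (measure_ne_top _ _)) key
  rwa [ENNReal.toReal_mul, ENNReal.toReal_ofReal (Real.exp_pos _).le] at this

end Entropy

/-! ### Compactness of transport plans. -/

section Coupling

variable {X : Type*} [MetricSpace X] [SecondCountableTopology X] [MeasurableSpace X] [BorelSpace X]

/-- The cost is the supremum of its truncations at level `M`, whose integrals are weakly continuous,
so the set is an intersection of closed sets. -/
lemma isClosed_setOf_lintegral_edist_sq_le (C : ℝ≥0∞) :
    IsClosed {π : ProbabilityMeasure (X × X) |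
      ∫⁻ z, edist z.1 z.2 ^ 2 ∂(π : Measure (X × X)) ≤ C} := by
  let f (M : ℕ) : X × X →ᵇ ℝ≥0 := BoundedContinuousFunction.mkOfBound
    ⟨fun z => min (nndist z.1 z.2 ^ 2) M, by fun_prop⟩ M fun z w => by
      rw [NNReal.dist_eq, abs_sub_le_iff]
      have h (u : X × X) : ((min (nndist u.1 u.2 ^ 2) (M : ℝ≥0) : ℝ≥0) : ℝ) ≤ M := by
        exact NNReal.coe_le_coe.2 (min_le_right _ _)
      have h1 := h z
      have h2 := h w
      have h3 := (min (nndist z.1 z.2 ^ 2) (M : ℝ≥0)).coe_nonneg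
      have h4 := (min (nndist w.1 w.2 ^ 2) (M : ℝ≥0)).coe_nonneg
      constructor <;> simp only [ContinuousMap.coe_mk] <;> linarith
  have hsup (z : X × X) : edist z.1 z.2 ^ 2 = ⨆ M : ℕ, (f M z : ℝ≥0∞) := by
    refine le_antisymm ?_ (iSup_le fun M => ?_)
    · obtain ⟨M, hM⟩ := exists_nat_ge (nndist z.1 z.2 ^ 2)
      refine le_iSup_of_le M ?_
      have : f M z = nndist z.1 z.2 ^ 2 := min_eq_left hM
      rw [this, edist_nndist, ENNReal.coe_pow]
    · rw [edist_nndist, ← ENNReal.coe_pow, ENNReal.coe_le_coe]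
      exact min_le_left _ _
  have hmono : Monotone fun (M : ℕ) (z : X × X) => (f M z : ℝ≥0∞) := by
    intro M N hMN z
    rw [ENNReal.coe_le_coe]
    exact min_le_min_left _ (by exact_mod_cast hMN)
  have hset : {π : ProbabilityMeasure (X × X) |
      ∫⁻ z, edist z.1 z.2 ^ 2 ∂(π : Measure (X × X)) ≤ C} =
      ⋂ M : ℕ, {π : ProbabilityMeasure (X × X) | ∫⁻ z, f M z ∂(π : Measure (X × X)) ≤ C} := by
    ext π
    simp only [mem_ofPred_eq, mem_iInter]
    simp_rw [hsup]
    rw [lintegral_iSup (fun M => (f M).continuous.measurable.coe_nnreal_ennreal) hmono, iSup_le_iff]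
  rw [hset]
  exact isClosed_iInter fun M => isClosed_le
    (ProbabilityMeasure.continuous_lintegral_boundedContinuousFunction (f M)) continuous_const

/-- If measures with cost at most `C` have marginals arbitrarily close to `ν` and `μ`, then some
coupling of `ν` and `μ` has cost at most `C`. -/
lemma exists_coupling_of_approx [CompleteSpace X] (ν μ : ProbabilityMeasure X) (C : ℝ≥0∞)
    (h : ∀ U ∈ 𝓝 ν, ∀ V ∈ 𝓝 μ, ∃ π : ProbabilityMeasure (X × X),
      ∫⁻ z, edist z.1 z.2 ^ 2 ∂(π : Measure (X × X)) ≤ C ∧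
      π.map measurable_fst.aemeasurable ∈ U ∧ π.map measurable_snd.aemeasurable ∈ V) :
    ∃ π : ProbabilityMeasure (X × X),
      ∫⁻ z, edist z.1 z.2 ^ 2 ∂(π : Measure (X × X)) ≤ C ∧
      π.map measurable_fst.aemeasurable = ν ∧ π.map measurable_snd.aemeasurable = μ := by
  obtain ⟨U, hU⟩ := (𝓝 ν).exists_antitone_basis
  obtain ⟨V, hV⟩ := (𝓝 μ).exists_antitone_basis
  choose π hcost hfst hsnd using fun k => h (U k) (hU.mem k) (V k) (hV.mem k)
  have tfst : Tendsto (fun k => (π k).map measurable_fst.aemeasurable) atTop (𝓝 ν) :=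
    hU.tendsto hfst
  have tsnd : Tendsto (fun k => (π k).map measurable_snd.aemeasurable) atTop (𝓝 μ) :=
    hV.tendsto hsnd
  -- A convergent sequence is relatively compact, hence tight by the converse half of Prokhorov's
  -- theorem, which uses completeness. Tight marginals then make the plans tight.
  have tight {ρ : ℕ → ProbabilityMeasure X} {ρ' : ProbabilityMeasure X}
      (hρ : Tendsto ρ atTop (𝓝 ρ')) :
      IsTightMeasureSet {((m : ProbabilityMeasure X) : Measure X) | m ∈ range ρ} := by
    refine isTightMeasureSet_of_isCompact_closure ?_
    exact hρ.isCompact_insert_range.closure_of_subset (subset_insert _ _)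
  have hcomp : IsCompact (closure (range π)) := by
    refine isCompact_closure_of_isTightMeasureSet (.prodMk ?_ ?_)
    · refine (tight tfst).subset ?_
      rintro _ ⟨_, ⟨_, ⟨k, rfl⟩, rfl⟩, rfl⟩
      exact ⟨_, ⟨k, rfl⟩, rfl⟩
    · refine (tight tsnd).subset ?_
      rintro _ ⟨_, ⟨_, ⟨k, rfl⟩, rfl⟩, rfl⟩
      exact ⟨_, ⟨k, rfl⟩, rfl⟩
  obtain ⟨π', -, φ, hφ, hlim⟩ := hcomp.tendsto_subseq fun k => subset_closure (mem_range_self k)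
  refine ⟨π', ?_, ?_, ?_⟩
  · exact (isClosed_setOf_lintegral_edist_sq_le C).mem_of_tendsto hlim
      (Eventually.of_forall fun k => hcost (φ k))
  · exact tendsto_nhds_unique
      (ProbabilityMeasure.tendsto_map_of_tendsto_of_continuous _ _ hlim continuous_fst)
      (tfst.comp hφ.tendsto_atTop)
  · exact tendsto_nhds_unique
      (ProbabilityMeasure.tendsto_map_of_tendsto_of_continuous _ _ hlim continuous_snd)
      (tsnd.comp hφ.tendsto_atTop)

end Coupling

/-! ### From concentration to Talagrand's inequality. -/

section Concentration

/-- With `N = n + 1` the exponent is `N (t - a c) + 2 a r₀ √(N c) - a r₀²`, and the negative linear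
term wins. -/
lemma tendsto_gaussian_error {a c t : ℝ} (r₀ b : ℝ) (hc : 0 < c) (ht : t < a * c) :
    Tendsto (fun n : ℕ => Real.exp ((n + 1 : ℕ) * t) *
      (b * Real.exp (-a * (Real.sqrt ((n + 1 : ℕ) * c) - r₀) ^ 2))) atTop (𝓝 0) := by
  have hs : Tendsto (fun n : ℕ => Real.sqrt ((n + 1 : ℕ) : ℝ)) atTop atTop :=
    Real.tendsto_sqrt_atTop.comp (tendsto_natCast_atTop_atTop.comp (tendsto_add_atTop_nat 1))
  have h1 : Tendsto (fun n : ℕ => Real.sqrt ((n + 1 : ℕ) : ℝ) *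
      (Real.sqrt ((n + 1 : ℕ) : ℝ) * (t - a * c) + 2 * a * r₀ * Real.sqrt c)) atTop atBot :=
    hs.atTop_mul_atBot₀
      (tendsto_atBot_add_const_right _ _ (hs.atTop_mul_const_of_neg (sub_neg.2 ht)))
  have h2 := ((Real.tendsto_exp_atBot.comp h1).const_mul (b * Real.exp (-a * r₀ ^ 2)))
  rw [mul_zero] at h2
  refine h2.congr fun n => ?_
  have hN : (0 : ℝ) ≤ ((n + 1 : ℕ) : ℝ) := Nat.cast_nonneg _
  rw [Real.sqrt_mul hN, mul_left_comm, ← Real.exp_add, Function.comp_apply, mul_assoc,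
    ← Real.exp_add]
  congr 2
  linear_combination t * Real.sq_sqrt hN +
    a * Real.sqrt ((n + 1 : ℕ) : ℝ) ^ 2 * Real.sq_sqrt hc.le

variable {X : Type*} [MetricSpace X] [SecondCountableTopology X] [MeasurableSpace X] [BorelSpace X]

/-- Gaussian concentration produces cheap transport plans between laws close to `ν` and `μ`. -/
lemma exists_cheap_plan {μ ν : ProbabilityMeasure X} {a b r₀ c : ℝ}
    (hconc : GaussianConcentration (μ : Measure X) a b r₀)
    (hνμ : (ν : Measure X) ≪ μ) (hint : Integrable (llr (ν : Measure X) μ) ν)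
    (hc : 0 < c) (hc' : ∫ x, llr (ν : Measure X) μ x ∂(ν : Measure X) < a * c)
    {U V : Set (ProbabilityMeasure X)} (hU : U ∈ 𝓝 ν) (hV : V ∈ 𝓝 μ) :
    ∃ π : ProbabilityMeasure (X × X),
      ∫⁻ z, edist z.1 z.2 ^ 2 ∂(π : Measure (X × X)) ≤ ENNReal.ofReal c ∧
      π.map measurable_fst.aemeasurable ∈ U ∧ π.map measurable_snd.aemeasurable ∈ V := by
  set H := ∫ x, llr (ν : Measure X) μ x ∂(ν : Measure X)
  -- The gap `t - H` absorbs the fluctuation of the log-likelihood; the gap `a c - t` makes the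
  -- concentration error negligible.
  obtain ⟨t, hHt, htc⟩ := exists_between hc'
  let L (n : ℕ) : Set (Fin (n + 1) → X) :=
    {x | t - H ≤ |(∑ i, llr (ν : Measure X) μ (x i)) / ((n + 1 : ℕ) : ℝ) - H|}
  have hL := tendsto_power_deviation (ν : Measure X) (measurable_llr _ _) hint (sub_pos.2 hHt)
  let EU (n : ℕ) : Set (Fin (n + 1) → X) := {x | empirical x ∉ U}
  let EV (n : ℕ) : Set (Fin (n + 1) → X) := {x | empirical x ∉ V}
  have hEU : Tendsto (fun n => power (ν : Measure X) (n + 1) (EU n)) atTop (𝓝 0) :=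
    tendsto_power_empirical_notMem ν hU
  have hEV : Tendsto (fun n => power (μ : Measure X) (n + 1) (EV n)) atTop (𝓝 0) :=
    tendsto_power_empirical_notMem μ hV
  -- The exceptional sets need not be measurable, so they are replaced by measurable supersets of
  -- equal mass.
  let A (n : ℕ) := (toMeasurable (power (μ : Measure X) (n + 1)) (EV n))ᶜ
  let B (n : ℕ) := (toMeasurable (power (ν : Measure X) (n + 1)) (EU n ∪ L n))ᶜ
  have hAm (n : ℕ) : MeasurableSet (A n) := (measurableSet_toMeasurable _ _).compl
  have hBm (n : ℕ) : MeasurableSet (B n) := (measurableSet_toMeasurable _ _).compl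
  have hA : ∀ᶠ n in atTop, 1 / 2 ≤ (power (μ : Measure X) (n + 1)).real (A n) := by
    filter_upwards [hEV.eventually_lt_const (show (0 : ℝ≥0∞) < ENNReal.ofReal (1 / 2) by simp)]
      with n hn
    rw [probReal_compl_eq_one_sub (measurableSet_toMeasurable _ _), measureReal_def,
      measure_toMeasurable]
    have := ENNReal.toReal_mono ENNReal.ofReal_ne_top hn.le
    rw [ENNReal.toReal_ofReal (by norm_num)] at this
    linarith
  have hB : ∀ᶠ n in atTop, 1 / 2 ≤ (power (ν : Measure X) (n + 1)).real (B n) := by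
    have hsum := hEU.add hL
    rw [add_zero] at hsum
    filter_upwards [hsum.eventually_lt_const (show (0 : ℝ≥0∞) < ENNReal.ofReal (1 / 2) by simp)]
      with n hn
    rw [probReal_compl_eq_one_sub (measurableSet_toMeasurable _ _), measureReal_def,
      measure_toMeasurable]
    have := ENNReal.toReal_mono ENNReal.ofReal_ne_top ((measure_union_le (EU n) (L n)).trans hn.le)
    rw [ENNReal.toReal_ofReal (by norm_num)] at this
    linarith
  have hr : ∀ᶠ n : ℕ in atTop, r₀ ≤ Real.sqrt ((n + 1 : ℕ) * c) := by
    refine Tendsto.eventually_ge_atTop (Real.tendsto_sqrt_atTop.comp ?_) r₀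
    exact (tendsto_natCast_atTop_atTop.comp (tendsto_add_atTop_nat 1)).atTop_mul_const hc
  have herr := (tendsto_gaussian_error r₀ b hc htc).eventually_lt_const
    (show (0 : ℝ) < 1 / 2 by norm_num)
  obtain ⟨n, hAn, hBn, hrn, hen⟩ := (hA.and (hB.and (hr.and herr))).exists
  -- If `B` missed the enlargement, concentration would bound `μ^N(B)` by the Gaussian error, and
  -- the change of measure would force `ν^N(B) < 1/2`.
  obtain ⟨x, hxB, hxA⟩ : ∃ x ∈ B n, x ∈ enlargement (A n) (Real.sqrt ((n + 1 : ℕ) * c)) := by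
    by_contra! hcon
    have h1 := hconc (n + 1) (A n) (hAm n) hAn _ hrn
    have h2 : (power (μ : Measure X) (n + 1)).real
        (enlargement (A n) (Real.sqrt ((n + 1 : ℕ) * c))) ≤
        1 - (power (μ : Measure X) (n + 1)).real (B n) := by
      rw [← probReal_compl_eq_one_sub (hBm n)]
      exact measureReal_mono fun x hx hxB => hcon x hxB hx
    have h3 := power_le_exp_mul_power hνμ (hBm n) (t := (n + 1 : ℕ) * t) fun x hx => by
      have hxL : ¬ t - H ≤ |(∑ i, llr (ν : Measure X) μ (x i)) / ((n + 1 : ℕ) : ℝ) - H| := fun hx' => hx (subset_toMeasurable _ _ (Or.inr hx'))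
      have h4 := (abs_lt.1 (lt_of_not_ge hxL)).2
      rw [sub_lt_sub_iff_right, div_lt_iff₀ (by positivity)] at h4
      linarith
    have h5 := mul_le_mul_of_nonneg_left (show (power (μ : Measure X) (n + 1)).real (B n) ≤
      b * Real.exp (-a * (Real.sqrt ((n + 1 : ℕ) * c) - r₀) ^ 2) by linarith)
      (Real.exp_pos ((n + 1 : ℕ) * t)).le
    linarith
  obtain ⟨y, hyA, hxy⟩ := hxA
  have hxU : empirical x ∈ U := by
    by_contra hx
    exact hxB (subset_toMeasurable _ _ (Or.inl hx))
  have hyV : empirical y ∈ V := by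
    by_contra hy
    exact hyA (subset_toMeasurable _ _ hy)
  -- The empirical measure of the pairs has cost `ρ₂(x, y)² / N ≤ c`.
  refine ⟨empirical fun i => (x i, y i), ?_, ?_, ?_⟩
  · rw [lintegral_empirical _ (by fun_prop), mul_comm, ← div_eq_mul_inv]
    refine ENNReal.div_le_of_le_mul ?_
    have h6 : ∑ i, dist (x i) (y i) ^ 2 ≤ (n + 1 : ℕ) * c :=
      (Real.sqrt_le_sqrt_iff (by positivity)).1 hxy
    calc ∑ i, edist (x i) (y i) ^ 2 = ENNReal.ofReal (∑ i, dist (x i) (y i) ^ 2) := by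
          rw [ENNReal.ofReal_sum_of_nonneg fun i _ => by positivity]
          exact Finset.sum_congr rfl fun i _ => by
            rw [edist_dist, ENNReal.ofReal_pow dist_nonneg]
      _ ≤ ENNReal.ofReal ((n + 1 : ℕ) * c) := ENNReal.ofReal_le_ofReal h6
      _ = ENNReal.ofReal c * (n + 1 : ℕ) := by
          rw [mul_comm, ENNReal.ofReal_mul hc.le, ENNReal.ofReal_natCast]
  · rwa [map_empirical _ measurable_fst]
  · rwa [map_empirical _ measurable_snd]

theorem talagrandT2_of_gaussianConcentration [CompleteSpace X] {μ : Measure X}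
    [IsProbabilityMeasure μ] {a b r₀ : ℝ} (ha : 0 < a) (h : GaussianConcentration μ a b r₀) :
    TalagrandT2 μ (1 / a) := by
  intro ν hν
  by_cases hfin : InformationTheory.klDiv ν μ = ∞
  · rw [hfin, ENNReal.mul_top (by simpa using ha)]
    exact le_top
  obtain ⟨hνμ, hint⟩ := InformationTheory.klDiv_ne_top_iff.1 hfin
  have hkl : ENNReal.ofReal (1 / a) * InformationTheory.klDiv ν μ =
      ENNReal.ofReal (1 / a * (InformationTheory.klDiv ν μ).toReal) := by
    rw [ENNReal.ofReal_mul (by positivity), ENNReal.ofReal_toReal hfin]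
  have hH := InformationTheory.toReal_klDiv_of_measure_eq hνμ (by simp)
  rw [hkl]
  refine le_of_forall_gt fun d hd => ?_
  obtain ⟨c, -, hc, hcd⟩ := ENNReal.lt_iff_exists_real_btwn.1 hd
  have hHc : 1 / a * (InformationTheory.klDiv ν μ).toReal < c := by
    exact (ENNReal.ofReal_lt_ofReal_iff_of_nonneg (by positivity)).1 hc
  have hc0 : 0 < c := lt_of_le_of_lt (by positivity) hHc
  rw [one_div, inv_mul_lt_iff₀ ha, hH] at hHc
  obtain ⟨π, hπ, hfst, hsnd⟩ := exists_coupling_of_approx (⟨ν, hν⟩ : ProbabilityMeasure X)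
    ⟨μ, inferInstance⟩ (ENNReal.ofReal c) fun U hU V hV =>
      exists_cheap_plan (ν := ⟨ν, hν⟩) (μ := ⟨μ, inferInstance⟩) h hνμ hint hc0 hHc hU hV
  refine lt_of_le_of_lt (iInf₂_le_of_le (π : Measure (X × X)) ⟨?_, ?_⟩ hπ) hcd
  · exact congrArg Subtype.val hfst
  · exact congrArg Subtype.val hsnd

end Concentration

/-! ### Infimal convolution. -/

section InfConvolution

variable {Y : Type*} {c : Y → Y → ℝ} {f : Y → ℝ} {m M : ℝ}

/-- The infimal convolution `Q f (x) = inf_y (f y + c x y)` of `f` with the cost `c`. -/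
noncomputable def infConv (c : Y → Y → ℝ) (f : Y → ℝ) (x : Y) : ℝ := ⨅ y, (f y + c x y)

lemma bddBelow_infConv (hc : ∀ x y, 0 ≤ c x y) (hf : ∀ y, m ≤ f y) (x : Y) :
    BddBelow (range fun y => f y + c x y) :=
  ⟨m, by rintro _ ⟨y, rfl⟩; exact le_add_of_le_of_nonneg (hf y) (hc x y)⟩

lemma infConv_le (hc : ∀ x y, 0 ≤ c x y) (hf : ∀ y, m ≤ f y) (x y : Y) :
    infConv c f x ≤ f y + c x y :=
  ciInf_le (bddBelow_infConv hc hf x) y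

lemma abs_infConv_le (hc : ∀ x y, 0 ≤ c x y) (hcx : ∀ x, c x x = 0) (hf : ∀ y, |f y| ≤ M)
    (x : Y) : |infConv c f x| ≤ M := by
  have : Nonempty Y := ⟨x⟩
  refine abs_le.2 ⟨le_ciInf fun y => ?_, ?_⟩
  · exact le_add_of_le_of_nonneg (abs_le.1 (hf y)).1 (hc x y)
  · refine (infConv_le hc (fun y => (abs_le.1 (hf y)).1) x x).trans ?_
    rw [hcx, add_zero]
    exact (abs_le.1 (hf x)).2

/-- This supplies measurability, which an infimum over an uncountable family does not give by
itself. -/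
lemma upperSemicontinuous_infConv [TopologicalSpace Y] (hc : ∀ x y, 0 ≤ c x y)
    (hcont : ∀ y, Continuous fun x => c x y) (hf : ∀ y, m ≤ f y) :
    UpperSemicontinuous (infConv c f) :=
  upperSemicontinuous_ciInf (bddBelow_infConv hc hf) fun y =>
    (continuous_const.add (hcont y)).upperSemicontinuous

end InfConvolution

lemma integrable_of_abs_le {Ω : Type*} [MeasurableSpace Ω] {P : Measure Ω} [IsFiniteMeasure P]
    {f : Ω → ℝ} (hf : Measurable f) {M : ℝ} (hM : ∀ ω, |f ω| ≤ M) : Integrable f P :=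
  .of_bound hf.aestronglyMeasurable M (Eventually.of_forall hM)

lemma integrable_exp_mul_of_abs_le {Ω : Type*} [MeasurableSpace Ω] {P : Measure Ω}
    [IsFiniteMeasure P] {f : Ω → ℝ} (hf : Measurable f) {M : ℝ} (hM : ∀ ω, |f ω| ≤ M) {a : ℝ}
    (ha : 0 ≤ a) : Integrable (fun ω => Real.exp (a * f ω)) P := by
  refine .of_bound (by fun_prop) (Real.exp (a * M)) (Eventually.of_forall fun ω => ?_)
  rw [Real.norm_eq_abs, Real.abs_exp, Real.exp_le_exp]
  exact mul_le_mul_of_nonneg_left (abs_le.1 (hM ω)).2 ha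

/-! ### The dual form of T₂ and its tensorization. -/

section Dual

variable {X : Type*} [MetricSpace X] [MeasurableSpace X]

/-- The quadratic cost `ρ(x, y)²`. -/
def sqDist (x y : X) : ℝ := dist x y ^ 2

/-- The quadratic cost `∑ᵢ ρ(xᵢ, yᵢ)²` on `Xⁿ`. -/
def sumSqDist {n : ℕ} (x y : Fin n → X) : ℝ := ∑ i, sqDist (x i) (y i)

omit [MeasurableSpace X] in
lemma sqDist_nonneg (x y : X) : 0 ≤ sqDist x y := sq_nonneg _

omit [MeasurableSpace X] in
lemma sqDist_self (x : X) : sqDist x x = 0 := by simp [sqDist]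

omit [MeasurableSpace X] in
lemma continuous_sqDist (y : X) : Continuous fun x => sqDist x y := by
  unfold sqDist; fun_prop

omit [MeasurableSpace X] in
lemma sumSqDist_nonneg {n : ℕ} (x y : Fin n → X) : 0 ≤ sumSqDist x y :=
  Finset.sum_nonneg fun _ _ => sqDist_nonneg _ _

omit [MeasurableSpace X] in
lemma sumSqDist_self {n : ℕ} (x : Fin n → X) : sumSqDist x x = 0 := by
  simp [sumSqDist, sqDist_self]

omit [MeasurableSpace X] in
lemma continuous_sumSqDist {n : ℕ} (y : Fin n → X) : Continuous fun x => sumSqDist x y := by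
  unfold sumSqDist sqDist; fun_prop

omit [MeasurableSpace X] in
lemma sumSqDist_cons {n : ℕ} (x₀ y₀ : X) (x y : Fin n → X) :
    sumSqDist (Fin.cons x₀ x : Fin (n + 1) → X) (Fin.cons y₀ y) =
      sqDist x₀ y₀ + sumSqDist x y := by
  simp [sumSqDist, Fin.sum_univ_succ]

/-- The easy half of Kantorovich duality. -/
lemma ofReal_integral_sub_le_transportCost {ν μ : Measure X} [IsProbabilityMeasure ν]
    [IsProbabilityMeasure μ] {g f : X → ℝ} (hg : Integrable g ν) (hf : Integrable f μ)
    (hgf : ∀ x y, g x ≤ f y + sqDist x y) :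
    ENNReal.ofReal (∫ x, g x ∂ν - ∫ y, f y ∂μ) ≤ transportCost ν μ := by
  refine le_iInf₂ fun π ⟨hfst, hsnd⟩ => ?_
  have mfst : MeasurePreserving Prod.fst π ν := ⟨measurable_fst, hfst⟩
  have msnd : MeasurePreserving Prod.snd π μ := ⟨measurable_snd, hsnd⟩
  have hg' : Integrable (fun z : X × X => g z.1) π := mfst.integrable_comp_of_integrable hg
  have hf' : Integrable (fun z : X × X => f z.2) π := msnd.integrable_comp_of_integrable hf
  have e1 : ∫ x, g x ∂ν = ∫ z, g z.1 ∂π := by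
    rw [← hfst, integral_map (by fun_prop) (by rw [hfst]; exact hg.aestronglyMeasurable)]
  have e2 : ∫ x, f x ∂μ = ∫ z, f z.2 ∂π := by
    rw [← hsnd, integral_map (by fun_prop) (by rw [hsnd]; exact hf.aestronglyMeasurable)]
  have hint : Integrable (fun z : X × X => g z.1 - f z.2) π := hg'.sub hf'
  calc ENNReal.ofReal (∫ x, g x ∂ν - ∫ y, f y ∂μ)
      = ENNReal.ofReal (∫ z, (g z.1 - f z.2) ∂π) := by rw [e1, e2, integral_sub hg' hf']
    _ ≤ ENNReal.ofReal (∫ z, max (g z.1 - f z.2) 0 ∂π) :=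
        ENNReal.ofReal_le_ofReal (integral_mono hint hint.pos_part fun z => le_max_left _ _)
    _ = ∫⁻ z, ENNReal.ofReal (max (g z.1 - f z.2) 0) ∂π :=
        ofReal_integral_eq_lintegral_ofReal hint.pos_part
          (Eventually.of_forall fun z => le_max_right _ _)
    _ ≤ ∫⁻ z, edist z.1 z.2 ^ 2 ∂π := by
        refine lintegral_mono fun z => ?_
        rw [edist_dist, ← ENNReal.ofReal_pow dist_nonneg]
        exact ENNReal.ofReal_le_ofReal (max_le (sub_le_iff_le_add'.2 (hgf z.1 z.2)) (sq_nonneg _))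

/-- The relative entropy of an exponentially tilted probability measure. -/
lemma klDiv_tilted_self {Ω : Type*} [MeasurableSpace Ω] {μ : Measure Ω} [IsProbabilityMeasure μ]
    {g : Ω → ℝ} (hg : Measurable g) (hexp : Integrable (fun x => Real.exp (g x)) μ)
    (hint : Integrable g (μ.tilted g)) :
    InformationTheory.klDiv (μ.tilted g) μ ≠ ∞ ∧
      (InformationTheory.klDiv (μ.tilted g) μ).toReal =
        ∫ x, g x ∂(μ.tilted g) - Real.log (∫ x, Real.exp (g x) ∂μ) := by
  have hac := tilted_absolutelyContinuous μ g
  have := isProbabilityMeasure_tilted hexp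
  have hllr : llr (μ.tilted g) μ =ᵐ[μ.tilted g]
      fun x => g x - Real.log (∫ x, Real.exp (g x) ∂μ) := by
    refine hac.ae_eq ?_
    filter_upwards [llr_tilted_left (.refl μ) hexp hg.aemeasurable, llr_self μ] with x h1 h2
    rw [h1, h2, Pi.zero_apply, add_zero]
  have hint' : Integrable (llr (μ.tilted g) μ) (μ.tilted g) :=
    (integrable_congr hllr).2 (hint.sub (integrable_const _))
  refine ⟨InformationTheory.klDiv_ne_top hac hint', ?_⟩
  rw [InformationTheory.toReal_klDiv_of_measure_eq hac (by simp), integral_congr_ae hllr,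
    integral_sub hint (integrable_const _)]
  simp

variable [BorelSpace X] [SecondCountableTopology X]

omit [SecondCountableTopology X] in
/-- Talagrand's inequality implies the infimal convolution inequality. -/
lemma TalagrandT2.integral_exp_infConv_le {μ : Measure X} [IsProbabilityMeasure μ] {a : ℝ}
    (ha : 0 < a) (h : TalagrandT2 μ (1 / a)) {f : X → ℝ} (hf : Measurable f) {M : ℝ}
    (hM : ∀ x, |f x| ≤ M) :
    ∫ x, Real.exp (a * infConv sqDist f x) ∂μ ≤ Real.exp (a * ∫ x, f x ∂μ) := by
  have hfm : ∀ x, -M ≤ f x := fun x => (abs_le.1 (hM x)).1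
  set Q := infConv sqDist f
  have hQ : Measurable Q :=
    (upperSemicontinuous_infConv sqDist_nonneg continuous_sqDist hfm).measurable
  have hQM : ∀ x, |Q x| ≤ M := abs_infConv_le sqDist_nonneg sqDist_self hM
  have hexp : Integrable (fun x => Real.exp (a * Q x)) μ :=
    integrable_exp_mul_of_abs_le hQ hQM ha.le
  have hprob := isProbabilityMeasure_tilted hexp
  set ν := μ.tilted fun x => a * Q x
  have hQν : Integrable Q ν := integrable_of_abs_le hQ hQM
  have hfμ : Integrable f μ := integrable_of_abs_le hf hM
  obtain ⟨hfin, hkl⟩ := klDiv_tilted_self (hQ.const_mul a) hexp (hQν.const_mul a)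
  -- Both the dual bound (times `a`) and the entropy of the tilted measure contain `a ∫ Q dν`; it
  -- cancels, leaving `log ∫ e^{aQ} dμ ≤ a ∫ f dμ`.
  have key := (ofReal_integral_sub_le_transportCost hQν hfμ
    (infConv_le sqDist_nonneg hfm)).trans (h ν hprob)
  rw [← ENNReal.ofReal_toReal hfin, ← ENNReal.ofReal_mul (by positivity),
    ENNReal.ofReal_le_ofReal_iff (by positivity), hkl, integral_const_mul, one_div,
    le_inv_mul_iff₀ ha] at key
  have hpos : 0 < ∫ x, Real.exp (a * Q x) ∂μ := integral_exp_pos hexp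
  rw [← Real.log_le_iff_le_exp hpos]
  linarith

lemma measurable_infConv_sumSqDist {n : ℕ} {F : (Fin n → X) → ℝ} {M : ℝ} (hM : ∀ x, |F x| ≤ M) :
    Measurable (infConv sumSqDist F) :=
  (upperSemicontinuous_infConv sumSqDist_nonneg continuous_sumSqDist
    fun x => (abs_le.1 (hM x)).1).measurable

/-- Tensorization of the infimal convolution inequality. -/
lemma TalagrandT2.integral_exp_infConv_power_le {μ : Measure X} [IsProbabilityMeasure μ] {a : ℝ}
    (ha : 0 < a) (h : TalagrandT2 μ (1 / a)) {n : ℕ} {F : (Fin n → X) → ℝ} (hF : Continuous F)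
    {M : ℝ} (hM : ∀ x, |F x| ≤ M) :
    ∫ x, Real.exp (a * infConv sumSqDist F x) ∂(power μ n) ≤
      Real.exp (a * ∫ x, F x ∂(power μ n)) := by
  induction n with
  | zero =>
    have hQ (x : Fin 0 → X) : infConv sumSqDist F x = F default := by
      simp [infConv, sumSqDist, ciInf_unique]
    have hF' (x : Fin 0 → X) : F x = F default := congrArg F (Subsingleton.elim _ _)
    simp_rw [hQ]
    rw [integral_congr_ae (Eventually.of_forall hF')]
    simp
  | succ n ih =>
    have : Nonempty X := nonempty_of_isProbabilityMeasure μ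
    have hFm : ∀ x, -M ≤ F x := fun x => (abs_le.1 (hM x)).1
    have hcons : Continuous fun z : X × (Fin n → X) => (Fin.cons z.1 z.2 : Fin (n + 1) → X) :=
      continuous_pi fun i => by
        refine Fin.cases ?_ (fun j => ?_) i
        · simpa using continuous_fst
        · simp only [Fin.cons_succ]
          fun_prop
    have hFy (y : Fin n → X) : Continuous fun x₀ => F (Fin.cons x₀ y) :=
      hF.comp (hcons.comp (by fun_prop : Continuous fun x₀ : X => (x₀, y)))
    have hFx (x₀ : X) : Continuous fun y : Fin n → X => F (Fin.cons x₀ y) :=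
      hF.comp (hcons.comp (by fun_prop : Continuous fun y : Fin n → X => (x₀, y)))
    have hFint (y : Fin n → X) : Integrable (fun x₀ => F (Fin.cons x₀ y)) μ :=
      integrable_of_abs_le (hFy y).measurable fun _ => hM _
    let F' (y : Fin n → X) : ℝ := ∫ x₀, F (Fin.cons x₀ y) ∂μ
    have hF'M (y : Fin n → X) : |F' y| ≤ M := by
      have := norm_integral_le_of_norm_le_const (μ := μ) (f := fun x₀ => F (Fin.cons x₀ y))
        (Eventually.of_forall fun x₀ => hM (Fin.cons x₀ y))
      simpa using this
    -- Continuity is what the induction carries: it passes to the average `F'`, and it makes `g x`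
    -- below upper semicontinuous, hence measurable.
    have hF'c : Continuous F' := continuous_of_dominated (bound := fun _ => M)
      (fun y => (hFy y).aestronglyMeasurable)
      (fun y => Eventually.of_forall fun x₀ => hM _) (integrable_const _)
      (Eventually.of_forall hFx)
    -- The infimum is split: over the last `n` coordinates with `y₀` frozen, then over `y₀`. The
    -- one-factor inequality handles `y₀`, and the integral of an infimum is at most the infimum of
    -- the integrals.
    let g (x : Fin n → X) (y₀ : X) : ℝ := infConv sumSqDist (fun y => F (Fin.cons y₀ y)) x
    have hg_usc (x : Fin n → X) : UpperSemicontinuous (g x) :=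
      upperSemicontinuous_ciInf
        (fun y₀ => bddBelow_infConv sumSqDist_nonneg (fun y => hFm (Fin.cons y₀ y)) x)
        fun y => ((hFy y).add continuous_const).upperSemicontinuous
    have hgM (x : Fin n → X) (y₀ : X) : |g x y₀| ≤ M :=
      abs_infConv_le sumSqDist_nonneg sumSqDist_self (fun y => hM (Fin.cons y₀ y)) x
    have hg_int (x : Fin n → X) : Integrable (g x) μ :=
      integrable_of_abs_le (hg_usc x).measurable (hgM x)
    have hsplit (x₀ : X) (x : Fin n → X) :
        infConv sumSqDist F (Fin.cons x₀ x) ≤ infConv sqDist (g x) x₀ := by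
      refine le_ciInf fun y₀ => ?_
      rw [← sub_le_iff_le_add]
      refine le_ciInf fun y => ?_
      rw [sub_le_iff_le_add, add_assoc, add_comm (sumSqDist x y), ← sumSqDist_cons]
      exact infConv_le sumSqDist_nonneg hFm _ _
    have hQm := measurable_infConv_sumSqDist hM
    have hQM := abs_infConv_le sumSqDist_nonneg sumSqDist_self hM
    have hgint_le (x : Fin n → X) : ∫ y₀, g x y₀ ∂μ ≤ infConv sumSqDist F' x := by
      refine le_ciInf fun y => ?_
      calc ∫ y₀, g x y₀ ∂μ ≤ ∫ y₀, (F (Fin.cons y₀ y) + sumSqDist x y) ∂μ :=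
            integral_mono (hg_int x) ((hFint y).add (integrable_const _)) fun y₀ =>
              infConv_le sumSqDist_nonneg (fun y => hFm (Fin.cons y₀ y)) x y
        _ = F' y + sumSqDist x y := by
            rw [integral_add (hFint y) (integrable_const _)]; simp [F']
    have hexp : Integrable (fun x => Real.exp (a * infConv sumSqDist F x)) (power μ (n + 1)) :=
      integrable_exp_mul_of_abs_le hQm hQM ha.le
    obtain ⟨hint, heq⟩ := integral_power_succ μ hexp
    have hFpow := (integral_power_succ μ
      (integrable_of_abs_le (P := power μ (n + 1)) hF.measurable hM)).2
    rw [heq, hFpow]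
    refine (integral_mono hint ?_ fun x => ?_).trans (ih hF'c hF'M)
    · exact integrable_exp_mul_of_abs_le (measurable_infConv_sumSqDist hF'M)
        (abs_infConv_le sumSqDist_nonneg sumSqDist_self hF'M) ha.le
    · have hm0 : Measurable fun x₀ => infConv sumSqDist F (Fin.cons x₀ x) :=
        hQm.comp (hcons.comp (by fun_prop : Continuous fun x₀ : X => (x₀, x))).measurable
      have hmg : Measurable (infConv sqDist (g x)) :=
        (upperSemicontinuous_infConv sqDist_nonneg continuous_sqDist
          fun y₀ => (abs_le.1 (hgM x y₀)).1).measurable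
      calc ∫ x₀, Real.exp (a * infConv sumSqDist F (Fin.cons x₀ x)) ∂μ
          ≤ ∫ x₀, Real.exp (a * infConv sqDist (g x) x₀) ∂μ :=
            integral_mono (integrable_exp_mul_of_abs_le hm0 (fun _ => hQM _) ha.le)
              (integrable_exp_mul_of_abs_le hmg
                (abs_infConv_le sqDist_nonneg sqDist_self (hgM x)) ha.le)
              fun x₀ => Real.exp_le_exp.2 (mul_le_mul_of_nonneg_left (hsplit x₀ x) ha.le)
        _ ≤ Real.exp (a * ∫ y₀, g x y₀ ∂μ) :=
            h.integral_exp_infConv_le ha (hg_usc x).measurable (hgM x)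
        _ ≤ Real.exp (a * infConv sumSqDist F' x) :=
            Real.exp_le_exp.2 (mul_le_mul_of_nonneg_left (hgint_le x) ha.le)

end Dual

/-! ### The `ℓ²` distance to a set. -/

section DistanceToSet

variable {X : Type*} [MetricSpace X] {n : ℕ}

/-- The `ρ₂ⁿ`-distance from a point to a set. -/
noncomputable def infRhoTwo (A : Set (Fin n → X)) (x : Fin n → X) : ℝ :=
  Metric.infDist (WithLp.toLp 2 x : PiLp 2 fun _ : Fin n => X) (WithLp.toLp 2 '' A)

lemma dist_toLp_eq_rhoTwo (x y : Fin n → X) :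
    dist (WithLp.toLp 2 x : PiLp 2 fun _ : Fin n => X) (WithLp.toLp 2 y) = rhoTwo x y := by
  rw [PiLp.dist_eq_sum (by norm_num), rhoTwo, Real.sqrt_eq_rpow]
  simp

lemma rhoTwo_sq (x y : Fin n → X) : rhoTwo x y ^ 2 = sumSqDist x y :=
  Real.sq_sqrt (Finset.sum_nonneg fun _ _ => sq_nonneg _)

lemma rhoTwo_comm (x y : Fin n → X) : rhoTwo x y = rhoTwo y x := by
  simp_rw [rhoTwo, dist_comm]

lemma infRhoTwo_nonneg (A : Set (Fin n → X)) (x : Fin n → X) : 0 ≤ infRhoTwo A x :=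
  Metric.infDist_nonneg

lemma continuous_infRhoTwo (A : Set (Fin n → X)) : Continuous (infRhoTwo A) :=
  (Metric.continuous_infDist_pt _).comp (PiLp.continuous_toLp 2 _)

lemma infRhoTwo_le_rhoTwo {A : Set (Fin n → X)} {x : Fin n → X} (hx : x ∈ A) (y : Fin n → X) :
    infRhoTwo A y ≤ rhoTwo y x := by
  rw [← dist_toLp_eq_rhoTwo]
  exact Metric.infDist_le_dist_of_mem (mem_image_of_mem _ hx)

lemma infRhoTwo_le_add (A : Set (Fin n → X)) (x y : Fin n → X) :
    infRhoTwo A x ≤ infRhoTwo A y + rhoTwo x y := by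
  rw [← dist_toLp_eq_rhoTwo]
  exact Metric.infDist_le_infDist_add_dist

lemma mem_enlargement_of_infRhoTwo_lt {A : Set (Fin n → X)} (hA : A.Nonempty) {r : ℝ}
    {x : Fin n → X} (hx : infRhoTwo A x < r) : x ∈ enlargement A r := by
  obtain ⟨_, ⟨y, hy, rfl⟩, hxy⟩ := (Metric.infDist_lt_iff (hA.image _)).1 hx
  rw [dist_toLp_eq_rhoTwo] at hxy
  exact ⟨y, hy, hxy.le⟩

end DistanceToSet

/-! ### From Talagrand's inequality to concentration. -/

section Concentration

variable {X : Type*} [MetricSpace X] [MeasurableSpace X] [BorelSpace X]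
  [SecondCountableTopology X] {μ : Measure X} [IsProbabilityMeasure μ] {a : ℝ} {n : ℕ}

/-- A dimension-free bound for the truncated mean squared distance to a set. -/
lemma TalagrandT2.mul_integral_min_le (ha : 0 < a) (h : TalagrandT2 μ (1 / a))
    {A : Set (Fin n → X)} (hA : MeasurableSet A) (hpos : 0 < (power μ n).real A) {M : ℝ}
    (hM : 0 ≤ M) :
    a * ∫ x, min (infRhoTwo A x ^ 2) M ∂(power μ n) ≤ -Real.log ((power μ n).real A) := by
  -- Since the distance from `y` to `A` is at most `ρ₂(y, x)` for `x ∈ A`, the infimal convolution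
  -- is nonnegative on `A`, so its exponential dominates the indicator of `A`. The truncation keeps
  -- `F` bounded.
  set F : (Fin n → X) → ℝ := fun x => -min (infRhoTwo A x ^ 2) M
  have hFc : Continuous F :=
    (((continuous_infRhoTwo A).pow 2).min continuous_const).neg
  have hFM (x : Fin n → X) : |F x| ≤ M := by
    rw [abs_neg, abs_of_nonneg (le_min (sq_nonneg _) hM)]
    exact min_le_right _ _
  have hQA (x : Fin n → X) (hx : x ∈ A) : 0 ≤ infConv sumSqDist F x := by
    have : Nonempty (Fin n → X) := ⟨x⟩
    refine le_ciInf fun y => ?_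
    rw [← rhoTwo_sq, rhoTwo_comm]
    have h1 := pow_le_pow_left₀ (infRhoTwo_nonneg A y) (infRhoTwo_le_rhoTwo hx y) 2
    have h2 := min_le_left (infRhoTwo A y ^ 2) M
    simp only [F]
    linarith
  have hexp : Integrable (fun x => Real.exp (a * infConv sumSqDist F x)) (power μ n) :=
    integrable_exp_mul_of_abs_le (measurable_infConv_sumSqDist hFM)
      (abs_infConv_le sumSqDist_nonneg sumSqDist_self hFM) ha.le
  have key : (power μ n).real A ≤ Real.exp (a * ∫ x, F x ∂(power μ n)) := by
    refine le_trans ?_ (h.integral_exp_infConv_power_le ha hFc hFM)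
    rw [← integral_indicator_one hA]
    refine integral_mono ((integrable_const _).indicator hA) hexp fun x => ?_
    by_cases hx : x ∈ A
    · simpa [hx] using mul_nonneg ha.le (hQA x hx)
    · simpa [hx] using (Real.exp_pos _).le
  have := (Real.log_le_iff_le_exp hpos).2 key
  simp only [F, integral_neg] at this
  linarith

/-- The Laplace transform form of the concentration estimate. -/
lemma TalagrandT2.measureReal_le_infRhoTwo (ha : 0 < a) (h : TalagrandT2 μ (1 / a))
    {A : Set (Fin n → X)} (hA : MeasurableSet A) (hpos : 0 < (power μ n).real A)
    {r l : ℝ} (hr : 0 ≤ r) (hl : 0 < l) :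
    (power μ n).real {x | r ≤ infRhoTwo A x} * Real.exp (a * (l / (1 + l) * r ^ 2)) ≤
      Real.exp (l * -Real.log ((power μ n).real A)) := by
  -- At this cap `l M = r²`, which already exceeds the target `l/(1+l) r²`, itself the minimum of `l
  -- s² + (r - s)²` over `s`.
  set M := r ^ 2 / l
  have hM : 0 ≤ M := by positivity
  set F : (Fin n → X) → ℝ := fun x => l * min (infRhoTwo A x ^ 2) M
  have hFc : Continuous F :=
    continuous_const.mul (((continuous_infRhoTwo A).pow 2).min continuous_const)
  have hFM (x : Fin n → X) : |F x| ≤ l * M := by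
    rw [abs_of_nonneg (mul_nonneg hl.le (le_min (sq_nonneg _) hM))]
    exact mul_le_mul_of_nonneg_left (min_le_right _ _) hl.le
  have hQ (x : Fin n → X) (hx : r ≤ infRhoTwo A x) :
      l / (1 + l) * r ^ 2 ≤ infConv sumSqDist F x := by
    have : Nonempty (Fin n → X) := ⟨x⟩
    refine le_ciInf fun y => ?_
    rw [← rhoTwo_sq]
    have h1 : r ≤ infRhoTwo A y + rhoTwo x y := hx.trans (infRhoTwo_le_add A x y)
    rw [div_mul_eq_mul_div, div_le_iff₀ (by positivity)]
    rcases le_total M (infRhoTwo A y ^ 2) with hy | hy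
    · have h2 : F y = r ^ 2 := by
        simp only [F, min_eq_right hy, M]
        field_simp
      rw [h2]
      nlinarith [mul_nonneg (sq_nonneg (rhoTwo x y)) hl.le, sq_nonneg (rhoTwo x y), sq_nonneg r]
    · have h2 : F y = l * infRhoTwo A y ^ 2 := by simp only [F, min_eq_left hy]
      rw [h2]
      have h3 := mul_le_mul_of_nonneg_left (pow_le_pow_left₀ hr h1 2) hl.le
      -- With `s` the distance from `y` to `A` and `t = ρ₂(x, y)`: `(1+l)(l s² + t²) - l (s+t)² = (l
      -- s - t)²`.
      linarith [sq_nonneg (l * infRhoTwo A y - rhoTwo x y)]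
  have hexp : Integrable (fun x => Real.exp (a * infConv sumSqDist F x)) (power μ n) :=
    integrable_exp_mul_of_abs_le (measurable_infConv_sumSqDist hFM)
      (abs_infConv_le sumSqDist_nonneg sumSqDist_self hFM) ha.le
  have hmono : (power μ n).real {x | r ≤ infRhoTwo A x} ≤ (power μ n).real
      {x | Real.exp (a * (l / (1 + l) * r ^ 2)) ≤ Real.exp (a * infConv sumSqDist F x)} :=
    measureReal_mono fun x hx =>
      Real.exp_le_exp.2 (mul_le_mul_of_nonneg_left (hQ x hx) ha.le)
  have hmarkov := mul_meas_ge_le_integral_of_nonneg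
    (Eventually.of_forall fun x => (Real.exp_pos (a * infConv sumSqDist F x)).le) hexp
    (Real.exp (a * (l / (1 + l) * r ^ 2)))
  have hlap := h.integral_exp_infConv_power_le ha hFc hFM
  have hmean := mul_le_mul_of_nonneg_left (h.mul_integral_min_le ha hA hpos hM) hl.le
  calc (power μ n).real {x | r ≤ infRhoTwo A x} * Real.exp (a * (l / (1 + l) * r ^ 2))
      ≤ ∫ x, Real.exp (a * infConv sumSqDist F x) ∂(power μ n) := by
        rw [mul_comm]
        exact (mul_le_mul_of_nonneg_left hmono (Real.exp_pos _).le).trans hmarkov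
    _ ≤ Real.exp (l * -Real.log ((power μ n).real A)) := by
        refine hlap.trans (Real.exp_le_exp.2 ?_)
        simp only [F, integral_const_mul]
        linarith

theorem gaussianConcentration_of_talagrandT2 (ha : 0 < a) (h : TalagrandT2 μ (1 / a)) :
    GaussianConcentration μ a 1 (Real.sqrt (Real.log 2 / a)) := by
  intro n A hA hhalf r hr
  set r₀ := Real.sqrt (Real.log 2 / a)
  have hpos : 0 < (power μ n).real A := lt_of_lt_of_le (by norm_num) hhalf
  have hne : A.Nonempty := by
    by_contra hcon
    rw [not_nonempty_iff_eq_empty.1 hcon, measureReal_empty] at hpos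
    exact lt_irrefl _ hpos
  have hr₀ : 0 < r₀ := Real.sqrt_pos.2 (div_pos (Real.log_pos one_lt_two) ha)
  have hr₀sq : a * r₀ ^ 2 = Real.log 2 := by
    rw [Real.sq_sqrt (by positivity), mul_div_cancel₀ _ ha.ne']
  -- At `r = r₀` the claimed lower bound is 0; this case would give `l = 0` below.
  rcases hr.eq_or_lt with rfl | hlt
  · simp
  -- This value minimises `l log 2 - a l/(1+l) r²`, since `a r₀² = log 2`.
  set l := r / r₀ - 1
  have hl : 0 < l := by
    rw [sub_pos, one_lt_div hr₀]; exact hlt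
  have hlog : -Real.log ((power μ n).real A) ≤ Real.log 2 := by
    have := Real.log_le_log (by norm_num) hhalf
    rw [one_div, Real.log_inv] at this
    linarith
  have key := (h.measureReal_le_infRhoTwo ha hA hpos (hr₀.le.trans hr) hl).trans
    (Real.exp_le_exp.2 (mul_le_mul_of_nonneg_left hlog hl.le))
  rw [← le_div_iff₀ (Real.exp_pos _), ← Real.exp_sub] at key
  have hr_pos : 0 < r := hr₀.trans hlt
  have hexponent : l * Real.log 2 - a * (l / (1 + l) * r ^ 2) = -a * (r - r₀) ^ 2 := by
    have h1l : 1 + l = r / r₀ := by simp [l]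
    rw [h1l, ← hr₀sq]
    simp only [l]
    field_simp
    ring
  rw [hexponent] at key
  have hmeas : MeasurableSet {x | r ≤ infRhoTwo A x} :=
    (isClosed_le continuous_const (continuous_infRhoTwo A)).measurableSet
  have hsub : (power μ n).real {x | r ≤ infRhoTwo A x}ᶜ ≤ (power μ n).real (enlargement A r) :=
    measureReal_mono fun x hx => mem_enlargement_of_infRhoTwo_lt hne (lt_of_not_ge hx)
  rw [probReal_compl_eq_one_sub hmeas] at hsub
  linarith

end Concentration

end GaussTransport

theorem mainTheorem1 {X : Type*} [MetricSpace X] [CompleteSpace X]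
    [TopologicalSpace.SeparableSpace X] [MeasurableSpace X] [BorelSpace X]
    (μ : Measure X) [IsProbabilityMeasure μ] (hμ : GaussTransport.HasFiniteSecondMoment μ)
    (a : ℝ) (ha : 0 < a) :
    (∃ r₀ b : ℝ, 0 ≤ r₀ ∧ 0 ≤ b ∧ GaussTransport.GaussianConcentration μ a b r₀) ↔
      GaussTransport.TalagrandT2 μ (1 / a) := by
  have : SecondCountableTopology X := UniformSpace.secondCountable_of_separable X
  constructor
  · rintro ⟨r₀, b, -, -, h⟩
    exact GaussTransport.talagrandT2_of_gaussianConcentration ha h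
  · exact fun h => ⟨_, 1, Real.sqrt_nonneg _, zero_le_one,
      GaussTransport.gaussianConcentration_of_talagrandT2 ha h⟩
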